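/- For a set $A\subseteq\mathbb R$ let $A-A=\{|a-b| : a,b\in A,\ a\ne b\}$ denote its set of positive differences. For integers $n\ge k\ge 1$ and $\ell\ge 0$, let $g(n,k,\ell)$ be the minimum of $|A-A|$ over all $n$-element sets $A\subseteq\mathbb R$ such that $|A'-A'|\ge \ell$ for every $k$-element subset $A'\subseteq A$; if there is no such set $A$, put $g(n,k,\ell)=+\infty$. For fixed $k$, the quadratic threshold is the smallest integer $\ell\ge 0$ such that $g(n,k,\ell)=\Omega(n^2)$. All asymptotic notation is for $n\to\infty$ with $k$ and $\ell$ fixed, and implied constants may depend on $k$ and $\ell$. For every even positive integer $k$, $$g\left(n,k,\frac{k^2}{4}\right)=o(n^2)\qquad\text{and}\qquad g\left(n,k,\frac{k^2}{4}+1\right)=\Omega(n^2).$$ In particular, the quadratic threshold is exactly $\frac{k^2}{4}+1$. -/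

import Mathlib

open Filter
open scoped ENNReal

namespace LocalDiff

/-- The set of positive differences of `A ⊆ ℝ`: all `|a - b|` with `a, b ∈ A` distinct. -/
def diffSet (A : Set ℝ) : Set ℝ :=
  {d | ∃ a ∈ A, ∃ b ∈ A, a ≠ b ∧ d = |a - b|}

/-- The `(k, ℓ)`-local property: every `k`-element subset of `A` has at least `ℓ` positive
differences. -/
def LocalProperty (k ℓ : ℕ) (A : Finset ℝ) : Prop :=
  ∀ B : Finset ℝ, B ⊆ A → B.card = k → (ℓ : ℕ∞) ≤ (diffSet (B : Set ℝ)).encard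

/-- `g n k ℓ` is the minimum number of positive differences of an `n`-element set of reals with
the `(k, ℓ)`-local property; it is `⊤` (that is, `+∞`) when there is no such set. An infimum of
a nonempty family in `ℕ∞` is attained, so this is a minimum. -/
noncomputable def g (n k ℓ : ℕ) : ℕ∞ :=
  ⨅ (A : Finset ℝ) (_ : A.card = n) (_ : LocalProperty k ℓ A), (diffSet (A : Set ℝ)).encard

/-- `f n = o(h n)` as `n → ∞`, for extended natural valued `f` and nonnegative real `h`.
In particular `f n` is then finite for all large `n`. -/
def IsLittleO (f : ℕ → ℕ∞) (h : ℕ → ℝ) : Prop :=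
  ∀ ε : ℝ, 0 < ε → ∀ᶠ n in atTop, (f n : ℝ≥0∞) ≤ ENNReal.ofReal (ε * h n)

/-- `f n = Ω(h n)` as `n → ∞`, for extended natural valued `f` and nonnegative real `h`. -/
def IsOmega (f : ℕ → ℕ∞) (h : ℕ → ℝ) : Prop :=
  ∃ c : ℝ, 0 < c ∧ ∀ᶠ n in atTop, ENNReal.ofReal (c * h n) ≤ (f n : ℝ≥0∞)

/-- `ℓ` is the quadratic threshold for `k`: the smallest `ℓ` with `g n k ℓ = Ω(n ^ 2)`. -/
def IsQuadraticThreshold (k ℓ : ℕ) : Prop :=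
  IsLeast {m : ℕ | IsOmega (fun n => g n k m) (fun n => (n : ℝ) ^ 2)} ℓ

end LocalDiff

/-!
Write `k = 2 * m`, so that `k ^ 2 / 4 = m ^ 2`.

If `|A - A|` is less than a small multiple of `n ^ 2`, the energy inequality
`n ^ 4 ≤ |A - A| * E[A, -A]` makes some sum `s` so popular that `A` contains `m` pairs
`{a, s - a}`. These form a symmetric `2 * m`-set with only `m ^ 2` positive differences
(`exists_subset_card_posDiffs_le`), which gives the quadratic lower bound for `ℓ = m ^ 2 + 1`.

In the other direction, let the defect `t` of a finite set `B` be `#B` minus the least size of a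
subset of `B` that determines `B` up to Freiman homomorphism; it counts the independent additive
relations in `B`. The key fact (`exists_determines_card_posDiffs`) is that coincidences cost `B` at
most `t * (t + 1)` of its `(#B).choose 2` differences. It is proved by adding the points in
increasing order: a new maximum `x` that takes part in some relation raises the defect, and at most
`2 * t` of its differences to the earlier points are lost, since at least half of the points related
to `x` are recoverable from the other points (`exists_determines_insert`). As
`(2 * m).choose 2 - (m - 1) * m = m ^ 2`, every `2 * m`-set with fewer than `m ^ 2` differences has
defect at least `m`, that is, `m` of its points determine it.

Only `O(N ^ m)` of the `2 * m`-subsets of `{0, …, N - 1}` are determined by `m` of their points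
(`card_filter_determines_le`). With `N = ⌊ε * n ^ 2⌋`, averaging leaves boundedly many of them in
some `2 * n`-subset, and deleting a point of each yields `n` integers with the local property for
`ℓ = m ^ 2` and at most `ε * n ^ 2` differences.
-/

namespace LocalDiff

open Finset
open scoped Combinatorics.Additive Pointwise

/-! ### Positive differences of finite sets -/

/-- The positive differences of a finite set, as a finset. -/
noncomputable def posDiffs (A : Finset ℝ) : Finset ℝ := A.offDiag.image fun p => |p.1 - p.2|

lemma mem_posDiffs {A : Finset ℝ} {d : ℝ} :
    d ∈ posDiffs A ↔ ∃ a ∈ A, ∃ b ∈ A, a ≠ b ∧ d = |a - b| := by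
  simp only [posDiffs, mem_image, mem_offDiag, Prod.exists]
  constructor
  · rintro ⟨a, b, ⟨ha, hb, hab⟩, rfl⟩
    exact ⟨a, ha, b, hb, hab, rfl⟩
  · rintro ⟨a, ha, b, hb, hab, rfl⟩
    exact ⟨a, b, ⟨ha, hb, hab⟩, rfl⟩

lemma encard_diffSet (A : Finset ℝ) : (diffSet (A : Set ℝ)).encard = #(posDiffs A) := by
  rw [← Set.encard_coe_eq_coe_finsetCard]
  congr 1
  ext d
  simp [diffSet, mem_posDiffs]

lemma posDiffs_mono {A B : Finset ℝ} (h : A ⊆ B) : posDiffs A ⊆ posDiffs B :=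
  image_subset_image (offDiag_mono h)

lemma card_sub_le_two_mul_posDiffs (A : Finset ℝ) : #(A + -A) ≤ 2 * #(posDiffs A) + 1 := by
  have h : A + -A ⊆ insert 0 (posDiffs A ∪ (posDiffs A).image fun d => -d) := by
    intro x hx
    obtain ⟨a, ha, b, hb, rfl⟩ := mem_add.1 hx
    rw [mem_neg'] at hb
    rcases eq_or_ne a (-b) with hab | hab
    · simp [hab]
    have hd : |a - -b| ∈ posDiffs A := mem_posDiffs.2 ⟨a, ha, -b, hb, hab, rfl⟩
    rw [sub_neg_eq_add] at hd
    refine mem_insert_of_mem (mem_union.2 ?_)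
    rcases abs_choice (a + b) with h | h
    · exact Or.inl (h ▸ hd)
    · exact Or.inr (mem_image.2 ⟨_, hd, by rw [h, neg_neg]⟩)
  have h₁ := card_le_card h
  have h₂ := card_insert_le 0 (posDiffs A ∪ (posDiffs A).image fun d => -d)
  have h₃ := card_union_le (posDiffs A) ((posDiffs A).image fun d => -d)
  have h₄ : #((posDiffs A).image fun d => -d) ≤ #(posDiffs A) := card_image_le
  omega

/-! ### Popular sums and symmetric subsets -/

/-- A quadruple counted by the energy `E[A, -A]` is a pair of representations of one and the same
sum, so few representations of each sum mean small energy and hence many differences. -/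
lemma sq_card_le_of_card_rep_le {A : Finset ℝ} {M : ℕ}
    (hM : ∀ s : ℝ, #{a ∈ A | s - a ∈ A} ≤ M) :
    #A ^ 2 ≤ (2 * #(posDiffs A) + 1) * M := by
  rcases A.eq_empty_or_nonempty with rfl | hA
  · simp
  have hE : E[A, -A] ≤ M * #A ^ 2 := by
    rw [addEnergy, sq, ← card_product]
    refine card_le_mul_card_image_of_maps_to
      (f := fun x : (ℝ × ℝ) × ℝ × ℝ => (x.1.1, -x.2.2)) ?_ M ?_
    · rintro ⟨⟨a₁, a₂⟩, b₁, b₂⟩ hx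
      simp only [mem_filter, mem_product, mem_neg'] at hx ⊢
      exact ⟨hx.1.1.1, hx.1.2.2⟩
    · rintro ⟨a, b⟩ -
      refine (card_le_card_of_injOn (fun x => x.1.2) ?_ ?_).trans (hM (a + b))
      · rintro ⟨⟨a₁, a₂⟩, b₁, b₂⟩ hx
        simp only [coe_filter, mem_filter, mem_product, mem_neg', Set.mem_ofPred_eq,
          Prod.mk.injEq] at hx ⊢
        obtain ⟨⟨⟨⟨h₁, h₂⟩, h₃, h₄⟩, h₅⟩, rfl, rfl⟩ := hx
        refine ⟨h₂, ?_⟩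
        convert h₃ using 1
        linarith
      · rintro ⟨⟨a₁, a₂⟩, b₁, b₂⟩ hx ⟨⟨c₁, c₂⟩, d₁, d₂⟩ hy h
        simp only [coe_filter, mem_filter, Set.mem_ofPred_eq, Prod.mk.injEq] at hx hy h ⊢
        obtain ⟨⟨-, hx⟩, rfl, rfl⟩ := hx
        obtain ⟨⟨-, hy⟩, rfl, hd⟩ := hy
        obtain rfl := neg_injective hd
        subst h
        exact ⟨⟨rfl, rfl⟩, by linarith, rfl⟩
  have h := le_card_add_mul_addEnergy A (-A)
  rw [card_neg] at h
  have hpos : 0 < #A ^ 2 := by positivity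
  refine Nat.le_of_mul_le_mul_right ?_ hpos
  calc #A ^ 2 * #A ^ 2 ≤ #(A + -A) * E[A, -A] := h
    _ ≤ (2 * #(posDiffs A) + 1) * (M * #A ^ 2) :=
      Nat.mul_le_mul (card_sub_le_two_mul_posDiffs A) hE
    _ = _ := by ring

/-- A set symmetric about `s / 2` that consists of `m` pairs has at most `m ^ 2` differences. -/
lemma exists_subset_card_posDiffs_le {A : Finset ℝ} {s : ℝ} {m : ℕ}
    (h : 2 * m < #{a ∈ A | s - a ∈ A}) :
    ∃ B ⊆ A, #B = 2 * m ∧ #(posDiffs B) ≤ m ^ 2 := by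
  set T₀ : Finset ℝ := {a ∈ A | s - a ∈ A ∧ a < s - a} with hT₀
  have hcover : ({a ∈ A | s - a ∈ A} : Finset ℝ) ⊆ insert (s / 2) (T₀ ∪ T₀.image (s - ·)) := by
    intro a ha
    obtain ⟨ha, hsa⟩ := mem_filter.1 ha
    rw [mem_insert, mem_union, mem_image]
    rcases lt_trichotomy a (s - a) with hlt | heq | hgt
    · exact Or.inr (Or.inl (mem_filter.2 ⟨ha, hsa, hlt⟩))
    · exact Or.inl (by linarith)
    · refine Or.inr (Or.inr ⟨s - a, mem_filter.2 ⟨hsa, ?_, ?_⟩, by ring⟩)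
      · rwa [sub_sub_cancel]
      · rwa [sub_sub_cancel]
  have hm : m ≤ #T₀ := by
    have h₁ := card_le_card hcover
    have h₂ := card_insert_le (s / 2) (T₀ ∪ T₀.image (s - ·))
    have h₃ := card_union_le T₀ (T₀.image (s - ·))
    have h₄ : #(T₀.image (s - ·)) ≤ #T₀ := card_image_le
    omega
  obtain ⟨T, hT, hTm⟩ := exists_subset_card_eq hm
  have hTA : ∀ a ∈ T, a ∈ A ∧ s - a ∈ A ∧ a < s - a := fun a ha => mem_filter.1 (hT ha)
  refine ⟨T ∪ T.image (s - ·), ?_, ?_, ?_⟩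
  · refine union_subset (fun a ha => (hTA a ha).1) fun x hx => ?_
    obtain ⟨a, ha, rfl⟩ := mem_image.1 hx
    exact (hTA a ha).2.1
  · rw [card_union_of_disjoint, card_image_of_injective _ sub_right_injective, hTm, two_mul]
    rw [Finset.disjoint_left]
    intro a ha hx
    obtain ⟨b, hb, rfl⟩ := mem_image.1 hx
    have h₁ := (hTA _ ha).2.2
    have h₂ := (hTA _ hb).2.2
    linarith
  · -- Ordered pairs `a < b` index differences inside a half, the others those across the halves.
    have hsub : posDiffs (T ∪ T.image (s - ·)) ⊆
        (T ×ˢ T).image fun p => if p.1 < p.2 then |p.1 - p.2| else |s - p.1 - p.2| := by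
      have same : ∀ a ∈ T, ∀ b ∈ T, a ≠ b → |a - b| ∈
          (T ×ˢ T).image fun p => if p.1 < p.2 then |p.1 - p.2| else |s - p.1 - p.2| := by
        intro a ha b hb hab
        rcases hab.lt_or_gt with hlt | hlt
        · exact mem_image.2 ⟨(a, b), mk_mem_product ha hb, if_pos hlt⟩
        · exact mem_image.2 ⟨(b, a), mk_mem_product hb ha, by
            rw [if_pos hlt]; exact abs_sub_comm _ _⟩
      have cross : ∀ a ∈ T, ∀ b ∈ T, |s - a - b| ∈
          (T ×ˢ T).image fun p => if p.1 < p.2 then |p.1 - p.2| else |s - p.1 - p.2| := by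
        intro a ha b hb
        rcases le_or_gt b a with hle | hlt
        · exact mem_image.2 ⟨(a, b), mk_mem_product ha hb, if_neg hle.not_gt⟩
        · refine mem_image.2 ⟨(b, a), mk_mem_product hb ha, ?_⟩
          rw [if_neg hlt.not_gt, sub_right_comm]
      intro d hd
      obtain ⟨x, hx, y, hy, hxy, rfl⟩ := mem_posDiffs.1 hd
      rw [mem_union, mem_image] at hx hy
      rcases hx with hx | ⟨a, ha, rfl⟩ <;> rcases hy with hy | ⟨b, hb, rfl⟩
      · exact same x hx y hy hxy
      · have := cross b hb x hx
        rwa [abs_sub_comm] at this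
      · exact cross a ha y hy
      · have := same b hb a ha fun h => hxy (by rw [h])
        rwa [show s - a - (s - b) = b - a by ring]
    calc _ ≤ _ := card_le_card hsub
      _ ≤ #(T ×ˢ T) := card_image_le
      _ = m ^ 2 := by rw [card_product, hTm, sq]

/-- Sets in which every `2 * m` points have more than `m ^ 2` differences have quadratically many
differences. -/
lemma sq_card_le_of_localProperty {m : ℕ} {A : Finset ℝ}
    (hA : LocalProperty (2 * m) (m ^ 2 + 1) A) :
    #A ^ 2 ≤ (2 * #(posDiffs A) + 1) * (2 * m) := by
  refine sq_card_le_of_card_rep_le fun s => ?_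
  by_contra! h
  obtain ⟨B, hBA, hB, hd⟩ := exists_subset_card_posDiffs_le h
  have h' := hA B hBA hB
  rw [encard_diffSet, Nat.cast_le] at h'
  omega

/-! ### Subsets determining a finite set up to Freiman homomorphism -/

/-- `S` determines `B` if every `2`-Freiman homomorphism from `B` to `ℝ` that fixes `S` pointwise
fixes `B` pointwise. The number `#B - #S` then plays the role of the number of independent additive
relations `a + b = c + d` within `B`. -/
def Determines (S B : Finset ℝ) : Prop :=
  ∀ z : ℝ → ℝ, IsAddFreimanHom 2 (B : Set ℝ) Set.univ z → (∀ a ∈ S, z a = a) → ∀ a ∈ B, z a = a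

lemma Determines.mono {S S' B : Finset ℝ} (h : Determines S B) (hS : S ⊆ S') : Determines S' B :=
  fun z hz hzS => h z hz fun a ha => hzS a (hS ha)

lemma add_eq_of_isAddFreimanHom {B : Finset ℝ} {z : ℝ → ℝ}
    (hz : IsAddFreimanHom 2 (B : Set ℝ) Set.univ z) {a b c d : ℝ} (ha : a ∈ B) (hb : b ∈ B)
    (hc : c ∈ B) (hd : d ∈ B) (h : a + b = c + d) : z a + z b = z c + z d :=
  (isAddFreimanHom_two.1 hz).2 a ha b hb c hc d hd h

/-- The points `a` of `A` that occur in a relation `x + b = a + c` with `b, c ∈ A`. -/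
noncomputable def related (x : ℝ) (A : Finset ℝ) : Finset ℝ :=
  {a ∈ A | ∃ b ∈ A, ∃ c ∈ A, x + b = a + c}

/-- Passing from `A` to `insert x A`, where `x` exceeds all of `A`, every unrelated point `a` gives
a new difference `x - a`. -/
lemma card_posDiffs_insert {x : ℝ} {A : Finset ℝ} (hx : ∀ a ∈ A, a < x) :
    #(posDiffs A) + #A ≤ #(posDiffs (insert x A)) + #(related x A) := by
  have hsub : posDiffs A ∪ (A \ related x A).image (x - ·) ⊆ posDiffs (insert x A) := by
    refine union_subset (posDiffs_mono (subset_insert _ _)) fun d hd => ?_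
    obtain ⟨a, ha, rfl⟩ := mem_image.1 hd
    have haA := (mem_sdiff.1 ha).1
    exact mem_posDiffs.2 ⟨x, mem_insert_self _ _, a, mem_insert_of_mem haA, (hx a haA).ne',
      (abs_of_pos (sub_pos.2 (hx a haA))).symm⟩
  have hdisj : Disjoint (posDiffs A) ((A \ related x A).image (x - ·)) := by
    rw [Finset.disjoint_right]
    intro d hd hd'
    obtain ⟨a, ha, rfl⟩ := mem_image.1 hd
    obtain ⟨haA, har⟩ := mem_sdiff.1 ha
    obtain ⟨b, hb, c, hc, -, h⟩ := mem_posDiffs.1 hd'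
    refine har (mem_filter.2 ⟨haA, ?_⟩)
    rcases abs_choice (b - c) with h' | h'
    · exact ⟨c, hc, b, hb, by linarith⟩
    · exact ⟨b, hb, c, hc, by linarith⟩
  have h₁ := card_le_card hsub
  rw [card_union_of_disjoint hdisj, card_image_of_injective _ sub_right_injective] at h₁
  have h₂ := card_sdiff_add_card_eq_card (s := related x A) (t := A) (filter_subset _ _)
  omega

/-- Half of the related points can be left out of a determining set. Each related point `a` gets
the least `b` occurring in a relation `x + b = a + c`; then `c = x + b - a`, and `a` is left out
if the least `b` of `c` is smaller than that of `a`, or if they agree and `a ≤ c`. A point `a` left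
out is recovered from `x`, `b` and `c`, by induction on its least `b`. -/
lemma exists_determines_insert {x : ℝ} {A : Finset ℝ} (hx : ∀ a ∈ A, a < x) :
    ∃ S ⊆ insert x A, Determines S (insert x A) ∧ #(related x A) + 2 * #S ≤ 2 * (#A + 1) := by
  have hmin : ∀ a ∈ related x A, ∃ b ∈ A, x + b - a ∈ A ∧
      ∀ b' ∈ A, x + b' - a ∈ A → b ≤ b' := by
    intro a ha
    obtain ⟨-, b, hb, c, hc, h⟩ := mem_filter.1 ha
    have hne : ({b ∈ A | x + b - a ∈ A} : Finset ℝ).Nonempty :=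
      ⟨b, mem_filter.2 ⟨hb, by rwa [h, add_sub_cancel_left]⟩⟩
    refine ⟨_, (mem_filter.1 (min'_mem _ hne)).1, (mem_filter.1 (min'_mem _ hne)).2, ?_⟩
    exact fun b' hb' h' => min'_le _ _ (mem_filter.2 ⟨hb', h'⟩)
  choose! β hβA hβc hβmin using hmin
  set R := related x A with hR
  have hRA : R ⊆ A := filter_subset _ _
  let γ : ℝ → ℝ := fun a => x + β a - a
  have hγR : ∀ a ∈ R, γ a ∈ R := fun a ha =>
    mem_filter.2 ⟨hβc a ha, β a, hβA a ha, a, hRA ha, by simp only [γ]; ring⟩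
  have hβγ : ∀ a ∈ R, β (γ a) ≤ β a := fun a ha =>
    hβmin _ (hγR a ha) _ (hβA a ha) (by simp only [γ]; rw [sub_sub_cancel]; exact hRA ha)
  have hβlt : ∀ a ∈ R, β a < a := fun a ha => by
    have := hx _ (hβc a ha)
    linarith
  have hγinv : ∀ a, β (γ a) = β a → γ (γ a) = a := fun a h => by
    change x + β (γ a) - (x + β a - a) = a
    rw [h]; ring
  set P : Finset ℝ := {a ∈ R | β (γ a) < β a ∨ a ≤ γ a} with hP
  have hPR : P ⊆ R := filter_subset _ _
  have hγγ : ∀ a ∈ R \ P, β (γ a) = β a ∧ γ a < a := by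
    intro a ha
    obtain ⟨haR, haP⟩ := mem_sdiff.1 ha
    have h : ¬ (β (γ a) < β a ∨ a ≤ γ a) := fun h => haP (mem_filter.2 ⟨haR, h⟩)
    push Not at h
    exact ⟨le_antisymm (hβγ a haR) h.1, h.2⟩
  have hcard : #(R \ P) ≤ #P := by
    refine card_le_card_of_injOn γ (fun a ha => ?_) fun a ha b hb hab => ?_
    · obtain ⟨h₁, h₂⟩ := hγγ a ha
      refine mem_filter.2 ⟨hγR a (mem_sdiff.1 ha).1, Or.inr ?_⟩
      rw [hγinv a h₁]
      exact h₂.le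
    · rw [← hγinv a (hγγ a ha).1, hab, hγinv b (hγγ b hb).1]
  refine ⟨insert x (A \ P), insert_subset_insert _ sdiff_subset, ?_, ?_⟩
  · intro z hz hzS
    have hfix : ∀ a ∈ A, a ∉ P → z a = a := fun a ha haP =>
      hzS a (mem_insert_of_mem (mem_sdiff.2 ⟨ha, haP⟩))
    have hzx : z x = x := hzS x (mem_insert_self _ _)
    have key : ∀ a ∈ P, z a = a := by
      by_contra! hcon
      have hne : ({a ∈ P | z a ≠ a} : Finset ℝ).Nonempty := by
        obtain ⟨a, ha, h⟩ := hcon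
        exact ⟨a, mem_filter.2 ⟨ha, h⟩⟩
      obtain ⟨a, ha, hamin⟩ := exists_min_image _ β hne
      obtain ⟨haP, hza⟩ := mem_filter.1 ha
      have haR := hPR haP
      have hlt : ∀ b ∈ A, (b ∈ P → β b < β a) → z b = b := by
        intro b hb hba
        by_cases hbP : b ∈ P
        · by_contra hzb
          exact (hamin b (mem_filter.2 ⟨hbP, hzb⟩)).not_gt (hba hbP)
        · exact hfix b hb hbP
      have hzb : z (β a) = β a := hlt _ (hβA a haR) fun h => hβlt _ (hPR h)
      have hrel : z x + z (β a) = z a + z (γ a) :=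
        add_eq_of_isAddFreimanHom hz (mem_insert_self _ _) (mem_insert_of_mem (hβA a haR))
          (mem_insert_of_mem (hRA haR)) (mem_insert_of_mem (hβc a haR)) (by simp only [γ]; ring)
      rw [hzx, hzb] at hrel
      rcases (hβγ a haR).lt_or_eq with h | h
      · have hzc : z (γ a) = γ a := hlt _ (hβc a haR) fun _ => h
        simp only [γ] at hzc hrel
        exact hza (by linarith)
      · have hac : a ≤ γ a := ((mem_filter.1 haP).2).resolve_left h.not_lt
        have hγγa : γ (γ a) = a := hγinv a h
        by_cases hcP : γ a ∈ P
        · have hca : γ a = a := by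
            rcases (mem_filter.1 hcP).2 with h' | h'
            · rw [hγγa, h] at h'
              exact absurd h' (lt_irrefl _)
            · rw [hγγa] at h'
              exact le_antisymm h' hac
          rw [hca] at hrel
          have : x + β a - a = a := hca
          exact hza (by linarith)
        · have hzc := hfix _ (hβc a haR) hcP
          change z (γ a) = γ a at hzc
          simp only [γ] at hzc hrel
          exact hza (by linarith)
    intro a ha
    rcases mem_insert.1 ha with rfl | ha
    · exact hzx
    · by_cases haP : a ∈ P
      · exact key a haP
      · exact hfix a ha haP
  · have h₁ : #(insert x (A \ P)) ≤ #(A \ P) + 1 := card_insert_le _ _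
    have h₂ := card_sdiff_of_subset (hPR.trans hRA)
    have h₃ := card_le_card (hPR.trans hRA)
    have h₄ := card_sdiff_of_subset hPR
    have h₅ := card_le_card hPR
    omega

/-- Coincidences cost `B` at most `t * (t + 1)` of its `(#B).choose 2` possible differences, where
`t = #B - #S` for a suitable determining subset `S`. -/
theorem exists_determines_card_posDiffs (B : Finset ℝ) :
    ∃ S ⊆ B, Determines S B ∧
      (#B).choose 2 ≤ #(posDiffs B) + (#B - #S) * (#B - #S + 1) := by
  induction B using Finset.induction_on_max with
  | empty => exact ⟨∅, subset_rfl, fun _ _ h => h, by simp⟩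
  | insert x A hx ih =>
    obtain ⟨S, hSA, hS, hcard⟩ := ih
    have hxA : x ∉ A := fun h => lt_irrefl _ (hx x h)
    have hnew := card_posDiffs_insert hx
    have hSle := card_le_card hSA
    have hrestrict : ∀ z : ℝ → ℝ, IsAddFreimanHom 2 ((insert x A : Finset ℝ) : Set ℝ) Set.univ z →
        IsAddFreimanHom 2 (A : Set ℝ) Set.univ z := fun z hz =>
      hz.subset (by simp) (Set.mapsTo_univ _ _)
    have hchoose : (#A + 1).choose 2 = #A + (#A).choose 2 := by
      rw [Nat.choose_succ_succ' (#A) 1, Nat.choose_one_right]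
    rw [card_insert_of_notMem hxA, hchoose]
    rcases (related x A).eq_empty_or_nonempty with hR | ⟨a, ha⟩
    · refine ⟨insert x S, insert_subset_insert _ hSA, fun z hz hzS a ha => ?_, ?_⟩
      · rcases mem_insert.1 ha with rfl | ha
        · exact hzS _ (mem_insert_self _ _)
        · exact hS z (hrestrict z hz) (fun a ha => hzS a (mem_insert_of_mem ha)) a ha
      · rw [card_insert_of_notMem fun h => hxA (hSA h), Nat.add_sub_add_right]
        rw [hR, card_empty] at hnew
        omega
    · -- As `x = a + c - b`, the set determining `A` determines `insert x A` as well.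
      have hS' : Determines S (insert x A) := by
        intro z hz hzS
        have hA := hS z (hrestrict z hz) hzS
        intro y hy
        rcases mem_insert.1 hy with rfl | hy
        · obtain ⟨haA, b, hb, c, hc, h⟩ := mem_filter.1 ha
          have := add_eq_of_isAddFreimanHom hz (mem_insert_self _ _) (mem_insert_of_mem hb)
            (mem_insert_of_mem haA) (mem_insert_of_mem hc) h
          rw [hA a haA, hA b hb, hA c hc] at this
          linarith
        · exact hA y hy
      obtain ⟨S₂, hS₂A, hS₂, hcard₂⟩ := exists_determines_insert hx
      have hS₂le := card_le_card hS₂A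
      rw [card_insert_of_notMem hxA] at hS₂le
      rcases le_total (#S) (#S₂) with hle | hle
      · refine ⟨S, hSA.trans (subset_insert _ _), hS', ?_⟩
        obtain ⟨t, ht⟩ := Nat.exists_eq_add_of_le hSle
        have e₁ : #A - #S = t := by omega
        have e₂ : #A + 1 - #S = t + 1 := by omega
        rw [e₁] at hcard
        rw [e₂]
        have : #(related x A) ≤ 2 * (t + 1) := by omega
        nlinarith
      · refine ⟨S₂, hS₂A, hS₂, ?_⟩
        obtain ⟨t, ht⟩ := Nat.exists_eq_add_of_le hSle
        obtain ⟨u, hu⟩ := Nat.exists_eq_add_of_le hle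
        have e₁ : #A - #S = t := by omega
        have e₂ : #A + 1 - #S₂ = t + u + 1 := by omega
        rw [e₁] at hcard
        rw [e₂]
        have : #(related x A) ≤ 2 * (t + u + 1) := by omega
        nlinarith [Nat.zero_le (t * u), Nat.zero_le (u * u)]

/-- A `2 * m`-point set with fewer than `m ^ 2` differences is determined by `m` of its points. -/
lemma exists_determines_of_card_posDiffs_lt {m : ℕ} {B : Finset ℝ} (hB : #B = 2 * m)
    (h : #(posDiffs B) < m ^ 2) : ∃ S ⊆ B, #S = m ∧ Determines S B := by
  obtain ⟨S, hSB, hS, hcard⟩ := exists_determines_card_posDiffs B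
  have hSm : #S ≤ m := by
    by_contra! hlt
    obtain ⟨n, rfl⟩ : ∃ n, m = n + 1 := Nat.exists_eq_add_one.2 (by
      by_contra h0
      simp only [not_lt, nonpos_iff_eq_zero] at h0
      simp [h0] at h)
    have ht : #B - #S ≤ n := by omega
    have hmul : (#B - #S) * (#B - #S + 1) ≤ n * (n + 1) := by gcongr
    have hch : (#B).choose 2 = (n + 1) * (2 * n + 1) := by
      rw [hB, Nat.choose_two_right]
      refine Nat.div_eq_of_eq_mul_left two_pos ?_
      rw [show 2 * (n + 1) - 1 = 2 * n + 1 by omega]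
      ring
    rw [hch] at hcard
    nlinarith
  obtain ⟨S', hSS', hS'B, hS'⟩ := exists_subsuperset_card_eq hSB hSm (by omega : m ≤ #B)
  exact ⟨S', hS'B, hS', hS.mono hSS'⟩

/-! ### Counting and deletion -/

/-- Listing a `k`-set as a tuple, the tuple is recovered from its additive relations, the positions
of a determining subset and the entries at these positions. -/
lemma card_filter_determines_le (X : Finset ℝ) (k r : ℕ) [DecidablePred fun B : Finset ℝ =>
      ∃ S ⊆ B, #S = r ∧ Determines S B] :
    #{B ∈ X.powersetCard k | ∃ S ⊆ B, #S = r ∧ Determines S B} ≤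
      #X ^ r * (2 ^ (k ^ 4) * 2 ^ k) := by
  classical
  set Y : Finset (Fin k → ℝ) := {y ∈ Fintype.piFinset fun _ : Fin k => X | Function.Injective y ∧
    ∃ J : Finset (Fin k), #J = r ∧ Determines (J.image y) (univ.image y)} with hY
  have hYJ : ∀ y ∈ Y, ∃ J : Finset (Fin k), #J = r ∧ Determines (J.image y) (univ.image y) :=
    fun y hy => (mem_filter.1 hy).2.2
  choose! J hJr hJ using hYJ
  let Q : (Fin k → ℝ) → Finset (Fin k × Fin k × Fin k × Fin k) := fun y =>
    {q | y q.1 + y q.2.1 = y q.2.2.1 + y q.2.2.2}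
  have hYcard : #Y ≤ #X ^ r * (2 ^ (k ^ 4) * 2 ^ k) := by
    have h := card_le_mul_card_image_of_maps_to (s := Y) (t := univ) (f := fun y => (Q y, J y))
      (fun _ _ => mem_univ _) (#X ^ r) ?_
    · refine h.trans_eq ?_
      simp only [card_univ, Fintype.card_prod, Fintype.card_finset, Fintype.card_fin]
      congr 3
      ring
    · rintro ⟨q, j⟩ -
      rcases eq_empty_or_nonempty ({y ∈ Y | (Q y, J y) = (q, j)} : Finset (Fin k → ℝ)) with
        h | ⟨y₀, hy₀⟩
      · rw [h, card_empty]; exact Nat.zero_le _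
      have hj : #j = r := by
        obtain ⟨h, h'⟩ := mem_filter.1 hy₀
        rw [← (Prod.mk.inj h').2]
        exact hJr _ h
      have hpi : #(Fintype.piFinset fun _ : j => X) = #X ^ r := by
        rw [Fintype.card_piFinset, prod_const, card_univ, Fintype.card_coe, hj]
      rw [← hpi]
      refine card_le_card_of_injOn (fun y i => y i) (fun y hy => ?_) fun y hy y' hy' hyy' => ?_
      · have := Fintype.mem_piFinset.1 (mem_filter.1 (mem_filter.1 hy).1).1
        exact Fintype.mem_piFinset.2 fun i => this i
      · obtain ⟨hyY, h⟩ := mem_filter.1 hy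
        obtain ⟨hyY', h'⟩ := mem_filter.1 hy'
        obtain ⟨hQ, rfl⟩ := Prod.mk.inj h
        obtain ⟨hQ', hJJ⟩ := Prod.mk.inj h'
        have hinj := (mem_filter.1 hyY).2.1
        have hext : ∀ i, Function.extend y y' 0 (y i) = y' i := fun i => hinj.extend_apply y' 0 i
        have key := hJ y hyY (Function.extend y y' 0) ?_ ?_
        · funext i
          rw [← hext, key _ (mem_image_of_mem _ (mem_univ i))]
        · rw [isAddFreimanHom_two]
          refine ⟨Set.mapsTo_univ _ _, ?_⟩
          simp only [coe_image, coe_univ, Set.image_univ, Set.forall_mem_range, hext]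
          intro a b c d habcd
          have hmem : (a, b, c, d) ∈ Q y := by simpa [Q] using habcd
          rw [hQ, ← hQ'] at hmem
          simpa [Q] using hmem
        · intro a ha
          obtain ⟨i, hi, rfl⟩ := mem_image.1 ha
          rw [hext]
          exact (congrFun hyy' ⟨i, hi⟩).symm
  refine le_trans ?_ hYcard
  refine le_trans (card_le_card fun B hB => ?_) (card_image_le (f := fun y => univ.image y))
  obtain ⟨hB, S, hSB, hSr, hS⟩ := mem_filter.1 hB
  obtain ⟨hBX, hBk⟩ := mem_powersetCard.1 hB
  have hrange : univ.image (B.orderEmbOfFin hBk) = B := by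
    rw [← coe_inj, coe_image, coe_univ, Set.image_univ, range_orderEmbOfFin]
  have hSim : (S.preimage (B.orderEmbOfFin hBk) (B.orderEmbOfFin hBk).injective.injOn).image
      (B.orderEmbOfFin hBk) = S := by
    rw [image_preimage_of_bij]
    refine ⟨fun _ h => h, (B.orderEmbOfFin hBk).injective.injOn, fun s hs => ?_⟩
    have : s ∈ Set.range (B.orderEmbOfFin hBk) := by rw [range_orderEmbOfFin]; exact hSB hs
    obtain ⟨i, rfl⟩ := this
    exact ⟨i, hs, rfl⟩
  refine mem_image.2 ⟨B.orderEmbOfFin hBk, mem_filter.2 ⟨?_, (B.orderEmbOfFin hBk).injective,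
    S.preimage (B.orderEmbOfFin hBk) (B.orderEmbOfFin hBk).injective.injOn, ?_, ?_⟩, hrange⟩
  · exact Fintype.mem_piFinset.2 fun i => hBX (orderEmbOfFin_mem _ _ _)
  · rw [← hSr]
    conv_rhs => rw [← hSim]
    rw [card_image_of_injective _ (B.orderEmbOfFin hBk).injective]
  · rwa [hSim, hrange]

/-- Some `s`-subset contains at most the average number of members of a `k`-uniform family; it is
found by repeatedly deleting a point of at least average degree. -/
lemma exists_subset_card_filter_mul_choose_le {α : Type*} [DecidableEq α] {F : Finset (Finset α)}
    {k : ℕ} (hF : ∀ f ∈ F, #f = k) (X : Finset α) {s : ℕ} (hs : s ≤ #X) :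
    ∃ Y ⊆ X, #Y = s ∧ #{f ∈ F | f ⊆ Y} * (#X).choose k ≤ #F * s.choose k := by
  induction hs using Nat.decreasingInduction with
  | self =>
    exact ⟨X, subset_rfl, rfl, by gcongr; exact filter_subset _ _⟩
  | of_succ s hs ih =>
    obtain ⟨Y, hYX, hY, h⟩ := ih
    have hsum : ∑ v ∈ Y, #{f ∈ F | f ⊆ Y.erase v} = #{f ∈ F | f ⊆ Y} * (s + 1 - k) := by
      have hfilter : ∀ v ∈ Y, ({f ∈ F | f ⊆ Y.erase v} : Finset (Finset α)) =
          (F.filter (· ⊆ Y)).bipartiteAbove (fun v f => v ∉ f) v := by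
        intro v _
        rw [bipartiteAbove, filter_filter]
        simp only [subset_erase]
      rw [sum_congr rfl fun v hv => by rw [hfilter v hv],
        sum_card_bipartiteAbove_eq_sum_card_bipartiteBelow (fun v (f : Finset α) => v ∉ f),
        sum_const_nat (m := s + 1 - k)]
      intro f hf
      obtain ⟨hfF, hfY⟩ := mem_filter.1 hf
      rw [bipartiteBelow, filter_notMem_eq_sdiff, card_sdiff_of_subset hfY, hF f hfF, hY]
    have hne : Y.Nonempty := card_pos.1 (by omega)
    obtain ⟨v, hv, hle⟩ : ∃ v ∈ Y,
        #{f ∈ F | f ⊆ Y.erase v} * (s + 1) ≤ #{f ∈ F | f ⊆ Y} * (s + 1 - k) := by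
      refine exists_le_of_sum_le hne ?_
      rw [← sum_mul, hsum, sum_const, hY, smul_eq_mul, mul_comm]
    refine ⟨Y.erase v, (erase_subset _ _).trans hYX, by rw [card_erase_of_mem hv, hY]; rfl, ?_⟩
    refine Nat.le_of_mul_le_mul_right ?_ (Nat.succ_pos s)
    calc #{f ∈ F | f ⊆ Y.erase v} * (#X).choose k * (s + 1)
        = #{f ∈ F | f ⊆ Y.erase v} * (s + 1) * (#X).choose k := by ring
      _ ≤ #{f ∈ F | f ⊆ Y} * (s + 1 - k) * (#X).choose k := by gcongr
      _ = #{f ∈ F | f ⊆ Y} * (#X).choose k * (s + 1 - k) := by ring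
      _ ≤ #F * (s + 1).choose k * (s + 1 - k) := by gcongr
      _ = #F * s.choose k * (s + 1) := by
        rw [mul_assoc, mul_assoc, ← Nat.choose_mul_succ_eq]

/-- If few of the `k`-subsets of `X` lie in `F`, then `X` has an `n`-subset containing no member
of `F`: remove one point of each member from a subset of size `2 * n`. -/
lemma exists_subset_card_eq_forall_not_subset {α : Type*} [DecidableEq α] {F : Finset (Finset α)}
    {k n : ℕ} (hk : 0 < k) (hF : ∀ f ∈ F, #f = k) {X : Finset α} (hkX : k ≤ #X)
    (hn : 2 * n ≤ #X) (h : #F * (2 * n).choose k ≤ n * (#X).choose k) :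
    ∃ A ⊆ X, #A = n ∧ ∀ f ∈ F, ¬ f ⊆ A := by
  obtain ⟨Y, hYX, hY, hle⟩ := exists_subset_card_filter_mul_choose_le hF X hn
  have hfew : #{f ∈ F | f ⊆ Y} ≤ n :=
    Nat.le_of_mul_le_mul_right (hle.trans h) (Nat.choose_pos hkX)
  have hpt : ∀ f ∈ F, ∃ v, v ∈ f := fun f hf => card_pos.1 (hF f hf ▸ hk)
  rcases isEmpty_or_nonempty α with hα | hα
  · rw [eq_empty_of_isEmpty X, card_empty] at hkX
    omega
  choose! p hp using hpt
  have hcard : n ≤ #(Y \ ({f ∈ F | f ⊆ Y} : Finset (Finset α)).image p) := by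
    have h₁ := le_card_sdiff (({f ∈ F | f ⊆ Y} : Finset (Finset α)).image p) Y
    have h₂ := card_image_le (s := ({f ∈ F | f ⊆ Y} : Finset (Finset α))) (f := p)
    omega
  obtain ⟨A, hA, hAn⟩ := exists_subset_card_eq hcard
  refine ⟨A, (hA.trans sdiff_subset).trans hYX, hAn, fun f hf hfA => ?_⟩
  refine (mem_sdiff.1 (hA (hfA (hp f hf)))).2 (mem_image_of_mem p (mem_filter.2 ⟨hf, ?_⟩))
  exact (hfA.trans hA).trans sdiff_subset

lemma card_posDiffs_le_of_subset_range {A : Finset ℝ} {N : ℕ}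
    (hA : A ⊆ (range N).image (Nat.cast : ℕ → ℝ)) : #(posDiffs A) ≤ N := by
  have hsub : posDiffs A ⊆ (range N).image (Nat.cast : ℕ → ℝ) := by
    intro d hd
    obtain ⟨a, ha, b, hb, -, rfl⟩ := mem_posDiffs.1 hd
    obtain ⟨i, hi, rfl⟩ := mem_image.1 (hA ha)
    obtain ⟨j, hj, rfl⟩ := mem_image.1 (hA hb)
    rw [mem_range] at hi hj
    refine mem_image.2 ⟨((i : ℤ) - j).natAbs, mem_range.2 (by omega), ?_⟩
    rw [Nat.cast_natAbs]
    push_cast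
    rfl
  exact (card_le_card hsub).trans (card_image_le.trans_eq (card_range N))

/-- The hypothesis `h` expresses that `N` is at least a small multiple of `n ^ 2`. -/
lemma exists_localProperty {m n N : ℕ} (hm : 0 < m) (hmN : 4 * m ≤ N) (hnN : 2 * n ≤ N)
    (h : 2 ^ ((2 * m) ^ 4) * 2 ^ (2 * m) * (16 * n ^ 2) ^ m ≤ n * N ^ m) :
    ∃ A : Finset ℝ, #A = n ∧ LocalProperty (2 * m) (m ^ 2) A ∧ #(posDiffs A) ≤ N := by
  classical
  set X : Finset ℝ := (range N).image (Nat.cast : ℕ → ℝ) with hX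
  have hXN : #X = N := by rw [card_image_of_injective _ Nat.cast_injective, card_range]
  set F : Finset (Finset ℝ) :=
    {B ∈ X.powersetCard (2 * m) | ∃ S ⊆ B, #S = m ∧ Determines S B} with hF
  have hFcard := card_filter_determines_le X (2 * m) m
  rw [← hF, hXN] at hFcard
  have hbinom : #F * (2 * n).choose (2 * m) ≤ n * N.choose (2 * m) := by
    set K := 2 ^ ((2 * m) ^ 4) * 2 ^ (2 * m)
    have h₁ : (2 * m).factorial * (2 * n).choose (2 * m) ≤ (2 * n) ^ (2 * m) := by
      rw [← Nat.descFactorial_eq_factorial_mul_choose]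
      exact Nat.descFactorial_le_pow _ _
    have h₂ : N ^ (2 * m) ≤ 2 ^ (2 * m) * ((2 * m).factorial * N.choose (2 * m)) := by
      rw [← Nat.descFactorial_eq_factorial_mul_choose]
      calc N ^ (2 * m) ≤ (2 * (N + 1 - 2 * m)) ^ (2 * m) := by gcongr; omega
        _ = 2 ^ (2 * m) * (N + 1 - 2 * m) ^ (2 * m) := mul_pow _ _ _
        _ ≤ _ := by gcongr; exact Nat.pow_sub_le_descFactorial _ _
    refine Nat.le_of_mul_le_mul_right ?_
      (by positivity : 0 < (2 * m).factorial * 2 ^ (2 * m))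
    calc #F * (2 * n).choose (2 * m) * ((2 * m).factorial * 2 ^ (2 * m))
        = #F * ((2 * m).factorial * (2 * n).choose (2 * m)) * 2 ^ (2 * m) := by ring
      _ ≤ (N ^ m * K) * (2 * n) ^ (2 * m) * 2 ^ (2 * m) := by gcongr
      _ = N ^ m * (K * (16 * n ^ 2) ^ m) := by
        rw [pow_mul (2 * n), mul_assoc (N ^ m * K), pow_mul 2 2 m, ← mul_pow]
        rw [show (2 * n) ^ 2 * 2 ^ 2 = 16 * n ^ 2 by ring]
        ring
      _ ≤ N ^ m * (n * N ^ m) := by gcongr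
      _ = n * N ^ (2 * m) := by ring
      _ ≤ n * (2 ^ (2 * m) * ((2 * m).factorial * N.choose (2 * m))) := by gcongr
      _ = _ := by ring
  obtain ⟨A, hAX, hAn, hAF⟩ := exists_subset_card_eq_forall_not_subset (n := n) (F := F) (X := X)
    (by omega : 0 < 2 * m) (fun f hf => (mem_powersetCard.1 (mem_filter.1 hf).1).2)
    (by omega) (by omega) (by rwa [hXN])
  refine ⟨A, hAn, fun B hBA hB => ?_, card_posDiffs_le_of_subset_range hAX⟩
  rw [encard_diffSet, Nat.cast_le]
  by_contra! hlt
  exact hAF B (mem_filter.2 ⟨mem_powersetCard.2 ⟨hBA.trans hAX, hB⟩,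
    exists_determines_of_card_posDiffs_lt hB hlt⟩) hBA

/-! ### Asymptotics -/

lemma g_mono_right (n k : ℕ) {ℓ ℓ' : ℕ} (h : ℓ ≤ ℓ') : g n k ℓ ≤ g n k ℓ' := by
  refine le_iInf₂ fun A hA => le_iInf fun hloc => iInf₂_le_of_le A hA (iInf_le_of_le ?_ le_rfl)
  exact fun B hBA hB => (Nat.cast_le.2 h).trans (hloc B hBA hB)

lemma isLittleO_g {m : ℕ} (hm : 0 < m) :
    IsLittleO (fun n => g n (2 * m) (m ^ 2)) fun n => (n : ℝ) ^ 2 := by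
  intro ε hε
  set K : ℕ := 2 ^ ((2 * m) ^ 4) * 2 ^ (2 * m) with hK
  have hcast : Tendsto (fun n : ℕ => (n : ℝ)) atTop atTop := tendsto_natCast_atTop_atTop
  filter_upwards [hcast.eventually_ge_atTop (K * (32 / ε) ^ m), hcast.eventually_ge_atTop (2 / ε),
    hcast.eventually_ge_atTop ((2 * m + 2 : ℝ)), hcast.eventually_ge_atTop (4 / ε)]
    with n h₁ h₂ h₃ h₄
  rw [div_le_iff₀ hε] at h₂ h₄
  have hn : (0 : ℝ) ≤ n := n.cast_nonneg
  have hm' : (1 : ℝ) ≤ m := by exact_mod_cast hm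
  -- Once `ε * n ≥ 4`, rounding down costs at most half, and `4 * n ≤ ε * n ^ 2`.
  have hN₁ : ε * n ^ 2 / 2 ≤ (⌊ε * (n : ℝ) ^ 2⌋₊ : ℝ) := by
    have := Nat.sub_one_lt_floor (ε * (n : ℝ) ^ 2)
    nlinarith
  have hN₂ : (⌊ε * (n : ℝ) ^ 2⌋₊ : ℝ) ≤ ε * n ^ 2 := Nat.floor_le (by positivity)
  set N := ⌊ε * (n : ℝ) ^ 2⌋₊
  have hnN : 2 * n ≤ N := by
    have : (2 * n : ℝ) ≤ N := by nlinarith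
    exact_mod_cast this
  have hmN : 4 * m ≤ N := by
    have : 2 * m ≤ n := by
      have : (2 * m : ℝ) ≤ n := by linarith
      exact_mod_cast this
    omega
  have hmain : K * (16 * n ^ 2) ^ m ≤ n * N ^ m := by
    have : (K : ℝ) * (16 * n ^ 2) ^ m ≤ n * N ^ m := by
      calc (K : ℝ) * (16 * n ^ 2) ^ m = K * (32 / ε) ^ m * (ε * n ^ 2 / 2) ^ m := by
            rw [mul_assoc, ← mul_pow]
            congr 2
            field_simp
            ring
        _ ≤ (n : ℝ) * (N : ℝ) ^ m := by gcongr
    exact_mod_cast this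
  obtain ⟨A, hA, hloc, hd⟩ := exists_localProperty hm hmN hnN hmain
  have hg : g n (2 * m) (m ^ 2) ≤ (N : ℕ∞) := by
    refine iInf₂_le_of_le A hA (iInf_le_of_le hloc ?_)
    rw [encard_diffSet]
    exact_mod_cast hd
  calc ((g n (2 * m) (m ^ 2) : ℕ∞) : ℝ≥0∞) ≤ ((N : ℕ∞) : ℝ≥0∞) := ENat.toENNReal_le.2 hg
    _ = ENNReal.ofReal N := by rw [ENat.toENNReal_coe, ENNReal.ofReal_natCast]
    _ ≤ ENNReal.ofReal (ε * n ^ 2) := ENNReal.ofReal_le_ofReal hN₂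

lemma isOmega_g {m : ℕ} (hm : 0 < m) :
    IsOmega (fun n => g n (2 * m) (m ^ 2 + 1)) fun n => (n : ℝ) ^ 2 := by
  have hm' : (1 : ℝ) ≤ m := by exact_mod_cast hm
  refine ⟨1 / (8 * m), by positivity, ?_⟩
  filter_upwards [eventually_ge_atTop (4 * m)] with n hn
  have hn' : (4 * m : ℝ) ≤ n := by exact_mod_cast hn
  have hg : (⌈1 / (8 * m) * (n : ℝ) ^ 2⌉₊ : ℕ∞) ≤ g n (2 * m) (m ^ 2 + 1) := by
    refine le_iInf₂ fun A hA => le_iInf fun hloc => ?_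
    rw [encard_diffSet, Nat.cast_le, Nat.ceil_le]
    have h := sq_card_le_of_localProperty hloc
    rw [hA] at h
    have h' : (n : ℝ) ^ 2 ≤ (2 * #(posDiffs A) + 1) * (2 * m) := by exact_mod_cast h
    rw [div_mul_eq_mul_div, one_mul, div_le_iff₀ (by positivity)]
    nlinarith
  calc ENNReal.ofReal (1 / (8 * m) * (n : ℝ) ^ 2)
      ≤ ENNReal.ofReal (⌈1 / (8 * m) * (n : ℝ) ^ 2⌉₊ : ℝ) :=
        ENNReal.ofReal_le_ofReal (Nat.le_ceil _)
    _ = ((⌈1 / (8 * m) * (n : ℝ) ^ 2⌉₊ : ℕ∞) : ℝ≥0∞) := by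
        rw [ENat.toENNReal_coe, ENNReal.ofReal_natCast]
    _ ≤ _ := ENat.toENNReal_le.2 hg

lemma not_isOmega_of_isLittleO {f : ℕ → ℕ∞} (h : IsLittleO f fun n => (n : ℝ) ^ 2) :
    ¬ IsOmega f fun n => (n : ℝ) ^ 2 := by
  rintro ⟨c, hc, hf⟩
  obtain ⟨n, h₁, h₂, hn⟩ := (hf.and ((h (c / 2) (half_pos hc)).and (eventually_ge_atTop 1))).exists
  have hn' : (1 : ℝ) ≤ n := by exact_mod_cast hn
  have := (ENNReal.ofReal_le_ofReal_iff (by positivity)).1 (h₁.trans h₂)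
  nlinarith [mul_pos hc (by positivity : (0 : ℝ) < (n : ℝ) ^ 2)]

end LocalDiff

theorem corollary1p1 (k : ℕ) (hk : 0 < k) (hk_even : Even k) :
    LocalDiff.IsLittleO (fun n => LocalDiff.g n k (k ^ 2 / 4)) (fun n => (n : ℝ) ^ 2) ∧
      LocalDiff.IsOmega (fun n => LocalDiff.g n k (k ^ 2 / 4 + 1)) (fun n => (n : ℝ) ^ 2) ∧
      LocalDiff.IsQuadraticThreshold k (k ^ 2 / 4 + 1) := by
  obtain ⟨m, rfl⟩ := hk_even.exists_two_nsmul k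
  simp only [smul_eq_mul] at hk ⊢
  have hm : 0 < m := by omega
  have hdiv : (2 * m) ^ 2 / 4 = m ^ 2 :=
    Nat.div_eq_of_eq_mul_left (by norm_num) (by ring)
  rw [hdiv]
  refine ⟨LocalDiff.isLittleO_g hm, LocalDiff.isOmega_g hm, LocalDiff.isOmega_g hm, ?_⟩
  rintro ℓ ⟨c, hc, hℓ⟩
  by_contra! hlt
  refine LocalDiff.not_isOmega_of_isLittleO (LocalDiff.isLittleO_g hm) ⟨c, hc, ?_⟩
  filter_upwards [hℓ] with n hn
  exact hn.trans (ENat.toENNReal_le.2 (LocalDiff.g_mono_right n _ (Nat.lt_succ_iff.1 hlt)))
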